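/- Let $b=\lambda+i\eta$ with $\lambda,\eta\in\mathbb R$, $\lambda>0$. Let $\operatorname{arccot}(x)=\frac{\pi}{2}-\arctan x$ (continuous, decreasing from $\pi$ to $0$ on $\mathbb R$), let $\omega^{(\alpha,\beta)}(x)=(1+x^2)^{\beta-1}(e^{-\operatorname{arccot}x})^{\alpha}$, and let $(a)_n=a(a+1)\cdots(a+n-1)$. For $n\ge 0$ and $x\in\mathbb R$ define the (modified) complementary Romanovski–Routh polynomials $$\mathcal P_n(b;x)=\frac{(-1)^n}{2^n(\lambda)_n}\,\frac{(1+x^2)^n}{\omega^{(2\eta,-\lambda+1)}(x)}\,\frac{d^n}{dx^n}\,\omega^{(2\eta,-\lambda+1)}(x).$$ 1. For every $n\ge1$, $\mathcal P_n(b;\cdot)$ is a polynomial with real coefficients, and $$\mathcal P_n(b;x)=\frac{(x-i)^n}{2^n}\,\frac{(2\lambda)_n}{(\lambda)_n}\;{}_2F_1\Big(-n,b;\,b+\bar b;\,\frac{-2i}{x-i}\Big)$$ for all $x\in\mathbb R$ (and, for the polynomial extended to complex arguments, for all $x\in\mathbb C\setminus\{i\}$). 2. $\mathcal P_0(b;x)=1$,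 $\mathcal P_1(b;x)=x-c_1^{(b)}$, and for $n\ge1$ $$\mathcal P_{n+1}(b;x)=(x-c_{n+1}^{(b)})\mathcal P_n(b;x)-d_{n+1}^{(\lambda)}(x^2+1)\mathcal P_{n-1}(b;x),$$ where, for $n\ge1$, $c_n^{(b)}=\dfrac{\eta}{\lambda+n-1}$ and $d_{n+1}^{(\lambda)}=\dfrac14\,\dfrac{n(2\lambda+n-1)}{(\lambda+n-1)(\lambda+n)}$. 3. Suppose moreover that $\lambda>1/2$, and let $$\nu^{(\lambda,\eta)}(x)=\frac{2^{2\lambda-1}|\Gamma(b)|^2}{\Gamma(2\lambda-1)}\,\frac{e^{\eta\pi}}{2\pi}\,\omega^{(2\eta,-\lambda+1)}(x)=\frac{2^{2\lambda-1}|\Gamma(b)|^2}{\Gamma(2\lambda-1)}\,\frac{e^{\eta\pi}}{2\pi}\,\frac{(e^{-\operatorname{arccot}x})^{2\eta}}{(1+x^2)^{\lambda}}.$$ Then $\int_{-\infty}^{\infty}\nu^{(\lambda,\eta)}(x)\,dx=1$, and for all $n\ge0$ and $0\le m\le n$ $$\int_{-\infty}^{\infty}x^m\,\frac{\mathcal P_n(b;x)}{(1+x^2)^n}\,\nu^{(\lambda,\eta)}(x)\,dx=\gamma_n^{(\lambda)}\delta_{m,n},$$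 all integrals being absolutely convergent, where $\gamma_0^{(\lambda)}=1$ and $\gamma_n^{(\lambda)}=(1-\mathcal L_n^{(\lambda)})\gamma_{n-1}^{(\lambda)}$ with $\mathcal L_n^{(\lambda)}=\dfrac12\,\dfrac{2\lambda+n-2}{\lambda+n-1}$ for $n\ge1$. -/

import Mathlib

open Polynomial

noncomputable section

namespace CRR

/-- The branch of `arccot` that is continuous on `ℝ` and decreases from `π` to `0`. -/
def arccot (x : ℝ) : ℝ := Real.pi / 2 - Real.arctan x

/-- `ω^{(α,β)}(x) = (1+x²)^{β-1} (e^{-arccot x})^α`. -/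
def omega (α β x : ℝ) : ℝ :=
  (1 + x ^ 2) ^ (β - 1) * (Real.exp (-arccot x)) ^ α

/-- Complementary Romanovski-Routh polynomials `Q_n^{(α,β)}`, by their Rodrigues formula
(for `n = 0` it gives the constant `1`). -/
def Q (α β : ℝ) (n : ℕ) (x : ℝ) : ℝ :=
  (1 + x ^ 2) ^ n / omega α β x * iteratedDeriv n (omega α β) x

/-- The Pochhammer symbol `(a)_n = a (a+1) ⋯ (a+n-1)`. -/
def poch (a : ℝ) (n : ℕ) : ℝ := (ascPochhammer ℝ n).eval a

/-- The modified CRR polynomials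
`P_n(b;x) = (-1)^n / (2^n (λ)_n) · Q_n^{(2η, -λ+1)}(x)`, where `b = λ + iη`. -/
def P (b : ℂ) (n : ℕ) (x : ℝ) : ℝ :=
  (-1) ^ n / (2 ^ n * poch b.re n) * Q (2 * b.im) (-b.re + 1) n x

/-- `c_n^{(b)} = η / (λ+n-1)`. -/
def c (b : ℂ) (n : ℕ) : ℝ := b.im / (b.re + n - 1)

/-- `dSucc lam n` is `d_{n+1}^{(λ)} = (1/4) n (2λ+n-1) / ((λ+n-1)(λ+n))`. -/
def dSucc (lam : ℝ) (n : ℕ) : ℝ :=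
  1 / 4 * (n * (2 * lam + n - 1) / ((lam + n - 1) * (lam + n)))

/-- The constant in front of `ω^{(2η, -λ+1)}` in the weight `ν^{(λ,η)}`. -/
def nuConst (b : ℂ) : ℝ :=
  2 ^ (2 * b.re - 1) * ‖Complex.Gamma b‖ ^ 2 / Real.Gamma (2 * b.re - 1)
    * (Real.exp (b.im * Real.pi) / (2 * Real.pi))

/-- The weight `ν^{(λ,η)}`, where `b = λ + iη`. -/
def nu (b : ℂ) (x : ℝ) : ℝ := nuConst b * omega (2 * b.im) (-b.re + 1) x

/-- `L_n^{(λ)} = (1/2) (2λ+n-2) / (λ+n-1)`. -/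
def L (lam : ℝ) (n : ℕ) : ℝ := 1 / 2 * ((2 * lam + n - 2) / (lam + n - 1))

/-- `γ_0 = 1` and `γ_n = (1 - L_n) γ_{n-1}` for `n ≥ 1`. -/
def gam (lam : ℝ) : ℕ → ℝ
  | 0 => 1
  | n + 1 => (1 - L lam (n + 1)) * gam lam n

end CRR

end

/-! Each derivative of the weight has the form ω^(n) = (-1)^n q_n ω / (1+x²)^n, where the
polynomials q_n obey a first-order recursion, so P_n is q_n up to normalisation. The algebra rests
on q_{n+1}' = (n+1)(2λ+n) q_n (`derivative_rodriguesPoly_succ`). It turns the recursion into the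
three-term relation. Together with q_n(i) = (2i)^n (b)_n it also gives every Taylor coefficient at
i, which is the hypergeometric sum.

For orthogonality, repeated integration by parts kills x^m for m < n and leaves a multiple of ∫ω for
m = n (`integral_pow_mul_omegaDeriv`). The total mass comes from Plancherel: t^(b-1) e^(-t) on t > 0
has Fourier transform Γ(b) (1+2πiξ)^(-b), whose squared modulus is a multiple of ω(2πξ), while its
own L² norm is a Gamma integral (`norm_Gamma_sq_mul_integral_omega`). -/

namespace CRR

/-! ### Rodrigues polynomials and the three-term recurrence -/

/-- Polynomials with `ω^{(n)} = (-1)^n q_n ω / (1+x²)^n`. -/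
noncomputable def rodriguesPoly (b : ℂ) : ℕ → ℝ[X]
  | 0 => 1
  | n + 1 => (C (2 * (b.re + n)) * X - C (2 * b.im)) * rodriguesPoly b n
      - (X ^ 2 + 1) * derivative (rodriguesPoly b n)

theorem rodriguesPoly_zero (b : ℂ) : rodriguesPoly b 0 = 1 := rfl

theorem rodriguesPoly_succ (b : ℂ) (n : ℕ) : rodriguesPoly b (n + 1) =
    (C (2 * (b.re + n)) * X - C (2 * b.im)) * rodriguesPoly b n
      - (X ^ 2 + 1) * derivative (rodriguesPoly b n) := rfl

/-- Once the induction hypothesis replaces q_{n+1}' by a multiple of q_n, the derivative of the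
recursion regroups into the recursion one index lower, so only a multiple of q_{n+1} remains. -/
theorem derivative_rodriguesPoly_succ (b : ℂ) (n : ℕ) :
    derivative (rodriguesPoly b (n + 1)) =
      C ((n + 1) * (2 * b.re + n)) * rodriguesPoly b n := by
  induction n with
  | zero => simp [rodriguesPoly]
  | succ n ih =>
    rw [rodriguesPoly_succ b (n + 1)]
    simp only [derivative_sub, derivative_mul, derivative_add, derivative_C, derivative_X,
      derivative_X_pow, derivative_one, ih]
    have h := rodriguesPoly_succ b n
    generalize derivative (rodriguesPoly b n) = d at *
    rw [h]
    simp only [map_add, map_mul, map_natCast, map_one, map_ofNat, Nat.cast_add, Nat.cast_one]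
    ring

theorem natDegree_rodriguesPoly_le (b : ℂ) (n : ℕ) : (rodriguesPoly b n).natDegree ≤ n := by
  induction n with
  | zero => simp [rodriguesPoly]
  | succ n ih =>
    refine Nat.le_succ_of_pred_le ?_
    rw [Nat.pred_eq_sub_one, ← natDegree_derivative, derivative_rodriguesPoly_succ]
    exact (natDegree_C_mul_le _ _).trans ih

theorem one_add_sq_pos (x : ℝ) : 0 < 1 + x ^ 2 := by positivity

theorem omega_eq (b : ℂ) (x : ℝ) :
    omega (2 * b.im) (-b.re + 1) x =
      (1 + x ^ 2) ^ (-b.re) * Real.exp (-arccot x * (2 * b.im)) := by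
  rw [omega, Real.exp_mul, add_sub_cancel_right]

theorem omega_pos (b : ℂ) (x : ℝ) : 0 < omega (2 * b.im) (-b.re + 1) x := by
  rw [omega_eq]
  have := one_add_sq_pos x
  positivity

theorem hasDerivAt_omega (b : ℂ) (x : ℝ) :
    HasDerivAt (omega (2 * b.im) (-b.re + 1))
      ((2 * b.im - 2 * b.re * x) / (1 + x ^ 2) * omega (2 * b.im) (-b.re + 1) x) x := by
  have hx := one_add_sq_pos x
  have h1 : HasDerivAt (fun y : ℝ => 1 + y ^ 2) (2 * x) x := by
    simpa using (hasDerivAt_pow 2 x).const_add 1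
  have h2 := h1.rpow_const (p := -b.re) (Or.inl hx.ne')
  have h3 : HasDerivAt (fun y : ℝ => -arccot y * (2 * b.im))
      (1 / (1 + x ^ 2) * (2 * b.im)) x := by
    have : (fun y : ℝ => -arccot y * (2 * b.im)) =
        fun y => (Real.arctan y - Real.pi / 2) * (2 * b.im) := by
      funext y; simp [arccot]
    rw [this]
    exact ((Real.hasDerivAt_arctan x).sub_const _).mul_const _
  have h4 := h2.mul h3.exp
  rw [show omega (2 * b.im) (-b.re + 1) = _ from funext (omega_eq b)]
  refine h4.congr_deriv ?_
  rw [Real.rpow_sub hx, Real.rpow_one]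
  field_simp
  ring

/-- The `n`-th derivative of the weight, in closed form. -/
noncomputable def omegaDeriv (b : ℂ) (n : ℕ) (x : ℝ) : ℝ :=
  (-1) ^ n * (rodriguesPoly b n).eval x / (1 + x ^ 2) ^ n * omega (2 * b.im) (-b.re + 1) x

theorem hasDerivAt_omegaDeriv (b : ℂ) (n : ℕ) (x : ℝ) :
    HasDerivAt (omegaDeriv b n) (omegaDeriv b (n + 1) x) x := by
  have hx := one_add_sq_pos x
  have h1 : HasDerivAt (fun y : ℝ => (1 + y ^ 2) ^ n) (n * (1 + x ^ 2) ^ (n - 1) * (2 * x)) x := by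
    simpa using ((hasDerivAt_pow 2 x).const_add 1).fun_pow n
  have h2 := ((((rodriguesPoly b n).hasDerivAt x).const_mul ((-1) ^ n)).div h1
    (pow_pos hx n).ne').mul (hasDerivAt_omega b x)
  refine h2.congr_deriv ?_
  rw [omegaDeriv, rodriguesPoly_succ]
  simp only [Pi.div_apply, eval_sub, eval_mul, eval_add, eval_C, eval_X, eval_pow, eval_one]
  -- The exponent `n - 1` is truncated at `n = 0`, so that case is separate.
  rcases n with _ | n
  · simp; field_simp; ring
  · simp only [Nat.add_sub_cancel]
    push_cast
    field_simp
    ring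

theorem iteratedDeriv_omega (b : ℂ) (n : ℕ) :
    iteratedDeriv n (omega (2 * b.im) (-b.re + 1)) = omegaDeriv b n := by
  induction n with
  | zero => funext x; simp [omegaDeriv, rodriguesPoly]
  | succ n ih =>
    rw [iteratedDeriv_succ, ih]
    exact funext fun x => (hasDerivAt_omegaDeriv b n x).deriv

theorem P_eq (b : ℂ) (n : ℕ) (x : ℝ) :
    P b n x = (2 ^ n * poch b.re n)⁻¹ * (rodriguesPoly b n).eval x := by
  have hx := one_add_sq_pos x
  have hw := omega_pos b x
  have hs : ((-1 : ℝ) ^ n) * (-1) ^ n = 1 := by rw [← mul_pow]; simp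
  rw [P, Q, iteratedDeriv_omega, omegaDeriv]
  have : (1 + x ^ 2) ^ n / omega (2 * b.im) (-b.re + 1) x *
      ((-1) ^ n * eval x (rodriguesPoly b n) / (1 + x ^ 2) ^ n *
        omega (2 * b.im) (-b.re + 1) x) = (-1) ^ n * eval x (rodriguesPoly b n) := by
    field_simp
  rw [this, div_eq_mul_inv, mul_mul_mul_comm, hs, one_mul]

theorem poch_succ (a : ℝ) (n : ℕ) : poch a (n + 1) = poch a n * (a + n) :=
  ascPochhammer_succ_eval n a

theorem poch_zero (a : ℝ) : poch a 0 = 1 := by simp [poch]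

theorem poch_pos {a : ℝ} (ha : 0 < a) (n : ℕ) : 0 < poch a n := ascPochhammer_pos n a ha

/-- The derivative in the recursion is a multiple of the previous polynomial; the denominators of c
and d come from the ratios of the normalising constants. -/
theorem P_three_term {b : ℂ} (hb : 0 < b.re) {n : ℕ} (hn : 1 ≤ n) (x : ℝ) :
    P b (n + 1) x = (x - c b (n + 1)) * P b n x
      - dSucc b.re n * (x ^ 2 + 1) * P b (n - 1) x := by
  obtain ⟨n, rfl⟩ := Nat.exists_eq_add_of_le' hn
  have h1 : 0 < b.re + n := by positivity
  have h2 : 0 < b.re + (n + 1) := by positivity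
  have h3 := poch_pos hb n
  rw [Nat.add_sub_cancel, P_eq, P_eq, P_eq, rodriguesPoly_succ b (n + 1),
    derivative_rodriguesPoly_succ, poch_succ, poch_succ, c, dSucc]
  simp only [eval_sub, eval_mul, eval_add, eval_C, eval_X, eval_pow, eval_one]
  push_cast
  have e1 : b.re + (↑n + 1 + 1) - 1 = b.re + (n + 1) := by ring
  have e2 : b.re + (↑n + 1) - 1 = b.re + n := by ring
  rw [e1, e2]
  field_simp
  ring

/-! ### Expansion at i and the hypergeometric form -/

/-- The Taylor coefficients of `q_n` at `i`. -/
theorem coeff_taylor_rodriguesPoly (b : ℂ) (n j : ℕ) (hj : j ≤ n) :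
    (taylor Complex.I ((rodriguesPoly b n).map (algebraMap ℝ ℂ))).coeff j
        * (ascPochhammer ℂ (n - j)).eval (2 * (b.re : ℂ)) =
      n.choose j * (ascPochhammer ℂ n).eval (2 * (b.re : ℂ)) * (2 * Complex.I) ^ (n - j)
        * (ascPochhammer ℂ (n - j)).eval b := by
  induction n generalizing j with
  | zero => simp [Nat.le_zero.1 hj, rodriguesPoly]
  | succ n ih =>
    rcases j with _ | j
    -- Since X² + 1 vanishes at i, the recursion there reads q_{m+1}(i) = 2i(b+m) q_m(i).
    · have key : ∀ m, (taylor Complex.I ((rodriguesPoly b m).map (algebraMap ℝ ℂ))).coeff 0 =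
          (2 * Complex.I) ^ m * (ascPochhammer ℂ m).eval b := by
        intro m
        induction m with
        | zero => simp [rodriguesPoly]
        | succ m ihm =>
          rw [taylor_coeff_zero] at ihm ⊢
          have hI : (Complex.I) ^ 2 + 1 = 0 := by simp
          have hb : (b.re : ℂ) + b.im * Complex.I = b := Complex.re_add_im b
          rw [rodriguesPoly_succ, ascPochhammer_succ_eval]
          simp only [Polynomial.map_sub, Polynomial.map_mul, Polynomial.map_add, map_C, map_X,
            Polynomial.map_pow, Polynomial.map_one, eval_sub, eval_mul, eval_add, eval_C, eval_X,
            eval_pow, eval_one, hI, ihm, zero_mul, sub_zero, Complex.coe_algebraMap]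
          push_cast
          linear_combination (-2 * (b.im : ℂ)) * (2 * Complex.I) ^ m *
            (ascPochhammer ℂ m).eval b * Complex.I_sq + (2 * Complex.I) ^ m *
            (ascPochhammer ℂ m).eval b * (2 * Complex.I) * hb
      rw [key]; simp; ring
    -- Higher coefficients: the derivative relation expresses coefficient j+1 of q_{n+1} through
    -- coefficient j of q_n.
    · have hd : derivative (taylor Complex.I ((rodriguesPoly b (n + 1)).map (algebraMap ℝ ℂ))) =
          C ((n + 1) * (2 * (b.re : ℂ) + n)) *
            taylor Complex.I ((rodriguesPoly b n).map (algebraMap ℝ ℂ)) := by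
        rw [taylor_apply, derivative_comp, derivative_map, derivative_rodriguesPoly_succ]
        simp [taylor_apply]
      have hc := congrArg (fun p => p.coeff j) hd
      simp only [coeff_derivative, coeff_C_mul] at hc
      have hch : ((n + 1 : ℂ)) * n.choose j = (n + 1).choose (j + 1) * (j + 1) := by
        exact_mod_cast Nat.add_one_mul_choose_eq n j
      have h0 : (j + 1 : ℂ) ≠ 0 := by exact_mod_cast Nat.succ_ne_zero j
      rw [Nat.add_sub_add_right, ascPochhammer_succ_eval]
      apply mul_left_cancel₀ h0
      have hi := ih j (by omega)
      linear_combination (ascPochhammer ℂ (n - j)).eval (2 * (b.re : ℂ)) * hc +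
        ((n + 1) * (2 * (b.re : ℂ) + n)) * hi +
        (2 * (b.re : ℂ) + n) * (ascPochhammer ℂ n).eval (2 * (b.re : ℂ)) *
          (2 * Complex.I) ^ (n - j) * (ascPochhammer ℂ (n - j)).eval b * hch

/-- The series terminates because (-n)_k = (-1)^k k! C(n,k), which vanishes for k > n. -/
theorem hypergeometric_neg_nat (n : ℕ) (b c t : ℂ) :
    ordinaryHypergeometric (-(n : ℂ)) b c t = ∑ k ∈ Finset.range (n + 1),
      n.choose k * (ascPochhammer ℂ k).eval b / (ascPochhammer ℂ k).eval c * (-t) ^ k := by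
  rw [ordinaryHypergeometric_eq_tsum]
  dsimp only
  rw [tsum_eq_sum (s := Finset.range (n + 1))]
  · refine Finset.sum_congr rfl fun k hk => ?_
    have hk' : k ≤ n := Nat.lt_succ_iff.1 (Finset.mem_range.1 hk)
    rw [ascPochhammer_eval_neg_eq_descPochhammer, descPochhammer_eval_eq_descFactorial,
      Nat.descFactorial_eq_factorial_mul_choose]
    have : (k.factorial : ℂ) ≠ 0 := by exact_mod_cast k.factorial_ne_zero
    rw [smul_eq_mul, neg_pow t]
    push_cast
    field_simp
  · intro k hk
    have hk' : n < k := by simpa using hk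
    rw [(ascPochhammer_eval_eq_zero_iff k (-(n : ℂ))).2 ⟨n, hk', by simp⟩]
    simp

/-- This is the Taylor sum at i read backwards: term k of the series matches (z-i)^(n-k). Positivity
of λ permits division by (2λ)_k. -/
theorem aeval_rodriguesPoly (b : ℂ) (hb : 0 < b.re) (n : ℕ) {z : ℂ} (hz : z ≠ Complex.I) :
    aeval z (rodriguesPoly b n) = (z - Complex.I) ^ n * (poch (2 * b.re) n : ℂ) *
      ordinaryHypergeometric (-(n : ℂ)) b (b + (starRingEnd ℂ) b)
        (-2 * Complex.I / (z - Complex.I)) := by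
  have hu : z - Complex.I ≠ 0 := sub_ne_zero.2 hz
  have hbb : b + (starRingEnd ℂ) b = 2 * (b.re : ℂ) := by
    rw [Complex.add_conj]; push_cast; ring
  have hp : ∀ k, (ascPochhammer ℂ k).eval (2 * (b.re : ℂ)) = (poch (2 * b.re) k : ℂ) := by
    intro k
    rw [poch, ← Complex.coe_algebraMap, ← eval₂_at_apply, ← eval_map, ascPochhammer_map]
    simp
  have hp0 : ∀ k, (poch (2 * b.re) k : ℂ) ≠ 0 := fun k => by
    exact_mod_cast (poch_pos (by linarith) k).ne'
  have hT : aeval z (rodriguesPoly b n) =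
      (taylor Complex.I ((rodriguesPoly b n).map (algebraMap ℝ ℂ))).eval (z - Complex.I) := by
    rw [taylor_eval, sub_add_cancel, aeval_def, eval_map]
  rw [hT, eval_eq_sum_range' (n := n + 1), hypergeometric_neg_nat, Finset.mul_sum,
    ← Finset.sum_range_reflect]
  · refine Finset.sum_congr rfl fun k hk => ?_
    have hk' : k ≤ n := Nat.lt_succ_iff.1 (Finset.mem_range.1 hk)
    have h := coeff_taylor_rodriguesPoly b n (n - k) (Nat.sub_le _ _)
    rw [Nat.sub_sub_self hk', hp, hp, Nat.choose_symm hk'] at h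
    rw [hbb, hp, show n + 1 - 1 - k = n - k by omega, eq_div_of_mul_eq (hp0 k) h,
      show -(-2 * Complex.I / (z - Complex.I)) = 2 * Complex.I / (z - Complex.I) by ring, div_pow,
      ← pow_sub_mul_pow _ hk']
    have := hp0 k
    field_simp
  · rw [natDegree_taylor]
    exact Nat.lt_succ_of_le (natDegree_map_le.trans (natDegree_rodriguesPoly_le b n))

/-- Because 1 - L_n = n / (2(λ+n-1)), the product telescopes. -/
theorem gam_eq {a : ℝ} (ha : 0 < a) (n : ℕ) : gam a n = n.factorial / (2 ^ n * poch a n) := by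
  induction n with
  | zero => simp [gam, poch_zero]
  | succ n ih =>
    have h1 : 0 < a + n := by positivity
    have h3 := poch_pos ha n
    rw [gam, ih, poch_succ, Nat.factorial_succ, L]
    push_cast
    rw [show a + (↑n + 1) - 1 = a + n by ring]
    field_simp
    ring

end CRR

/-! ### Decay, integrability and orthogonality -/

namespace CRR

open MeasureTheory Filter Topology

theorem abs_eval_le_rpow (p : ℝ[X]) {k : ℕ} (hp : p.natDegree ≤ k) :
    ∃ K : ℝ, 0 ≤ K ∧ ∀ x : ℝ, |p.eval x| ≤ K * (1 + x ^ 2) ^ ((k : ℝ) / 2) := by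
  refine ⟨∑ i ∈ Finset.range (k + 1), |p.coeff i|,
    Finset.sum_nonneg fun _ _ => abs_nonneg _, fun x => ?_⟩
  rw [eval_eq_sum_range' (Nat.lt_succ_of_le hp), Finset.sum_mul]
  refine (Finset.abs_sum_le_sum_abs _ _).trans (Finset.sum_le_sum fun i hi => ?_)
  have hik : i ≤ k := Nat.lt_succ_iff.1 (Finset.mem_range.1 hi)
  rw [abs_mul]
  refine mul_le_mul_of_nonneg_left ?_ (abs_nonneg _)
  have h1 : |x| ≤ (1 + x ^ 2) ^ (1 / 2 : ℝ) := by
    rw [← Real.sqrt_eq_rpow, ← Real.sqrt_sq_eq_abs]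
    exact Real.sqrt_le_sqrt (by linarith)
  have h2 : (1 : ℝ) ≤ (1 + x ^ 2) ^ (1 / 2 : ℝ) :=
    Real.one_le_rpow (by nlinarith [sq_nonneg x]) (by norm_num)
  calc |x ^ i| = |x| ^ i := abs_pow x i
    _ ≤ ((1 + x ^ 2) ^ (1 / 2 : ℝ)) ^ i := pow_le_pow_left₀ (abs_nonneg x) h1 i
    _ ≤ ((1 + x ^ 2) ^ (1 / 2 : ℝ)) ^ k := pow_le_pow_right₀ h2 hik
    _ = (1 + x ^ 2) ^ ((k : ℝ) / 2) := by
      rw [← Real.rpow_natCast, ← Real.rpow_mul (one_add_sq_pos x).le]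
      congr 1; ring

theorem omega_le (b : ℂ) : ∃ K : ℝ, 0 ≤ K ∧ ∀ x : ℝ,
    omega (2 * b.im) (-b.re + 1) x ≤ K * (1 + x ^ 2) ^ (-b.re) := by
  refine ⟨Real.exp (Real.pi * |2 * b.im|), (Real.exp_pos _).le, fun x => ?_⟩
  rw [omega_eq, mul_comm]
  refine mul_le_mul_of_nonneg_right (Real.exp_le_exp.2 ?_)
    (Real.rpow_nonneg (one_add_sq_pos x).le _)
  refine (le_abs_self _).trans ?_
  rw [abs_mul, abs_neg]
  refine mul_le_mul_of_nonneg_right ?_ (abs_nonneg _)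
  rw [arccot, abs_le]
  have h1 := Real.arctan_lt_pi_div_two x
  have h2 := Real.neg_pi_div_two_lt_arctan x
  constructor <;> linarith [Real.pi_pos]

/-- Order count in |x|: at most m + n from the polynomial, -2n from the denominator, -2λ from the
weight. -/
theorem abs_pow_mul_omegaDeriv_le (b : ℂ) (n m : ℕ) : ∃ K : ℝ, 0 ≤ K ∧ ∀ x : ℝ,
    |x ^ m * omegaDeriv b n x| ≤ K * (1 + x ^ 2) ^ (-(2 * b.re + n - m) / 2) := by
  obtain ⟨K₁, hK₁, h₁⟩ := abs_eval_le_rpow (X ^ m * rodriguesPoly b n) (k := m + n)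
    (natDegree_mul_le.trans
      (add_le_add (natDegree_X_pow_le m) (natDegree_rodriguesPoly_le b n)))
  obtain ⟨K₂, hK₂, h₂⟩ := omega_le b
  refine ⟨K₁ * K₂, mul_nonneg hK₁ hK₂, fun x => ?_⟩
  have hx := one_add_sq_pos x
  have hw := omega_pos b x
  have e : |x ^ m * omegaDeriv b n x| =
      |(X ^ m * rodriguesPoly b n).eval x| * ((1 + x ^ 2) ^ (-(n : ℝ))) *
        omega (2 * b.im) (-b.re + 1) x := by
    rw [omegaDeriv, Real.rpow_neg hx.le, Real.rpow_natCast, eval_mul, eval_pow, eval_X]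
    simp only [abs_mul, abs_div, abs_pow, abs_neg, abs_one, one_pow, one_mul, abs_of_pos hw,
      abs_of_pos hx]
    ring
  rw [e]
  calc _ ≤ (K₁ * (1 + x ^ 2) ^ (((m + n : ℕ) : ℝ) / 2)) * ((1 + x ^ 2) ^ (-(n : ℝ))) *
        (K₂ * (1 + x ^ 2) ^ (-b.re)) := by
        gcongr
        · exact h₁ x
        · exact h₂ x
    _ = K₁ * K₂ * ((1 + x ^ 2) ^ (((m + n : ℕ) : ℝ) / 2) * (1 + x ^ 2) ^ (-(n : ℝ)) *
        (1 + x ^ 2) ^ (-b.re)) := by ring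
    _ = _ := by
      rw [← Real.rpow_add hx, ← Real.rpow_add hx]
      congr 2
      push_cast
      ring

theorem continuous_omegaDeriv (b : ℂ) (n : ℕ) : Continuous (omegaDeriv b n) :=
  continuous_iff_continuousAt.2 fun x => (hasDerivAt_omegaDeriv b n x).continuousAt

theorem integrable_one_add_sq_rpow {r : ℝ} (hr : 1 < r) :
    Integrable fun x : ℝ => (1 + x ^ 2) ^ (-r / 2) := by
  have := integrable_rpow_neg_one_add_norm_sq (E := ℝ) (μ := volume) (r := r) (by simpa)
  simpa using this

theorem integrable_pow_mul_omegaDeriv {b : ℂ} (hb : 1 / 2 < b.re) {n m : ℕ} (hm : m ≤ n) :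
    Integrable fun x => x ^ m * omegaDeriv b n x := by
  obtain ⟨K, -, h⟩ := abs_pow_mul_omegaDeriv_le b n m
  have hm' : (m : ℝ) ≤ n := by exact_mod_cast hm
  refine ((integrable_one_add_sq_rpow (r := 2 * b.re + n - m) (by linarith)).const_mul K).mono'
    ?_ (Eventually.of_forall h)
  have := continuous_omegaDeriv b n
  exact (by fun_prop : Continuous _).aestronglyMeasurable

/-- The range of m goes one beyond integrability, as the boundary terms below require; the exponent
is still negative since 2λ > 1. -/
theorem tendsto_pow_mul_omegaDeriv {b : ℂ} (hb : 1 / 2 < b.re) {n m : ℕ} (hm : m ≤ n + 1) :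
    Tendsto (fun x => x ^ m * omegaDeriv b n x) (cocompact ℝ) (𝓝 0) := by
  obtain ⟨K, -, h⟩ := abs_pow_mul_omegaDeriv_le b n m
  have hm' : (m : ℝ) ≤ n + 1 := by exact_mod_cast hm
  have ht : Tendsto (fun x : ℝ => 1 + x ^ 2) (cocompact ℝ) atTop := by
    refine tendsto_atTop_add_const_left _ _ ?_
    have := (tendsto_pow_atTop (α := ℝ) two_ne_zero).comp (tendsto_norm_cocompact_atTop (E := ℝ))
    simpa [Function.comp_def] using this
  have h0 := ((tendsto_rpow_neg_atTop (y := (2 * b.re + n - m) / 2) (by linarith)).comp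
    ht).const_mul K
  rw [mul_zero] at h0
  refine squeeze_zero_norm (fun x => ?_) h0
  rw [Real.norm_eq_abs, Function.comp_apply, ← neg_div]
  exact h x

/-- Each integration by parts lowers both m and n by one with factor -m; for m < n the power becomes
constant first and its derivative vanishes. -/
theorem integral_pow_mul_omegaDeriv {b : ℂ} (hb : 1 / 2 < b.re) {n m : ℕ} (hm : m ≤ n) :
    ∫ x, x ^ m * omegaDeriv b n x =
      if m = n then (-1) ^ n * n.factorial * ∫ x, omega (2 * b.im) (-b.re + 1) x else 0 := by
  induction n generalizing m with
  | zero => simp [Nat.le_zero.1 hm, omegaDeriv, rodriguesPoly]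
  | succ n ih =>
    have hi : Integrable fun x : ℝ => (m * x ^ (m - 1)) * omegaDeriv b n x := by
      rcases m with _ | m
      · simp
      · simpa [mul_assoc] using
          (integrable_pow_mul_omegaDeriv hb (Nat.le_of_succ_le_succ hm)).const_mul ((m : ℝ) + 1)
    have ht := tendsto_pow_mul_omegaDeriv hb hm
    have hbt := cocompact_eq_atBot_atTop (α := ℝ)
    have key := integral_mul_deriv_eq_deriv_mul (u := fun x : ℝ => x ^ m) (v := omegaDeriv b n)
      (fun x _ => hasDerivAt_pow m x) (fun x _ => hasDerivAt_omegaDeriv b n x)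
      (integrable_pow_mul_omegaDeriv hb hm) hi
      (ht.mono_left (hbt ▸ le_sup_left)) (ht.mono_left (hbt ▸ le_sup_right))
    rw [key]
    rcases m with _ | m
    · simp
    · simp only [Nat.add_sub_cancel, mul_assoc]
      rw [integral_const_mul, ih (Nat.le_of_succ_le_succ hm)]
      by_cases h : m = n
      · subst h
        simp [Nat.factorial_succ, pow_succ]
        ring
      · simp [h]

theorem pow_mul_P_mul_nu (b : ℂ) (n m : ℕ) (x : ℝ) :
    x ^ m * (P b n x / (1 + x ^ 2) ^ n) * nu b x =
      ((-1) ^ n * (2 ^ n * poch b.re n)⁻¹ * nuConst b) * (x ^ m * omegaDeriv b n x) := by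
  have hs : ((-1 : ℝ) ^ n) * (-1) ^ n = 1 := by rw [← mul_pow]; simp
  rw [P_eq, nu, omegaDeriv]
  linear_combination (-(2 ^ n * poch b.re n)⁻¹ * nuConst b * x ^ m * eval x (rodriguesPoly b n) /
    (1 + x ^ 2) ^ n * omega (2 * b.im) (-b.re + 1) x) * hs

end CRR

/-! ### Plancherel's theorem on L¹ ∩ L² -/

section Plancherel

open MeasureTheory SchwartzMap FourierTransform
open scoped ContDiff

theorem MeasureTheory.Lp.norm_sq_eq_integral (F : Lp (α := ℝ) ℂ 2) : ‖F‖ ^ 2 = ∫ x, ‖F x‖ ^ 2 := by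
  rw [@norm_sq_eq_re_inner ℂ, L2.inner_def]
  simp only [inner_self_eq_norm_sq_to_K]
  simp_rw [← RCLike.ofReal_pow]
  rw [integral_ofReal]
  simp

/-- The Fourier integral of an `L¹ ∩ L²` function is its `L²` Fourier transform. -/
theorem MeasureTheory.MemLp.fourier_toLp_ae_eq {f : ℝ → ℂ} (h1 : Integrable f)
    (h2 : MemLp f 2) : (𝓕 (h2.toLp f) : Lp (α := ℝ) ℂ 2 volume) =ᵐ[volume] 𝓕 f := by
  have hcont : Continuous (𝓕 f) :=
    VectorFourier.fourierIntegral_continuous Real.continuous_fourierChar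
      (innerSL ℝ).continuous₂ h1
  refine ae_eq_of_integral_contDiff_smul_eq
    ((Lp.memLp _).locallyIntegrable one_le_two) hcont.locallyIntegrable fun g hg hgc => ?_
  have hg₁ : HasCompactSupport (Complex.ofRealCLM ∘ g) := hgc.comp_left rfl
  have hg₂ : ContDiff ℝ ∞ (Complex.ofRealCLM ∘ g) := by fun_prop
  set φ : 𝓢(ℝ, ℂ) := hg₁.toSchwartzMap hg₂ with hφ
  have hφg : ∀ x, φ x = (g x : ℂ) := fun x => by simp [hφ]
  -- Both transforms agree as distributions: each can be moved onto the test function.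
  calc ∫ x, g x • (𝓕 (h2.toLp f) : Lp (α := ℝ) ℂ 2 volume) x
      = Lp.toTemperedDistribution (𝓕 (h2.toLp f) : Lp (α := ℝ) ℂ 2 volume) φ := by
        rw [Lp.toTemperedDistribution_apply]
        simp [hφg]
    _ = Lp.toTemperedDistribution (h2.toLp f) (𝓕 φ) := by
        rw [← Lp.fourier_toTemperedDistribution_eq, TemperedDistribution.fourier_apply]
    _ = ∫ x, (𝓕 φ) x • f x := by
        rw [Lp.toTemperedDistribution_apply]
        refine integral_congr_ae ?_
        filter_upwards [h2.coeFn_toLp] with x hx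
        rw [hx]
    _ = ∫ x, φ x • 𝓕 f x := by
        rw [fourier_coe]
        simpa using! VectorFourier.integral_fourierIntegral_smul_eq_flip (L := innerₗ ℝ)
          Real.continuous_fourierChar continuous_inner φ.integrable h1
    _ = ∫ x, g x • 𝓕 f x := by simp [hφg]

/-- Plancherel's theorem for `L¹ ∩ L²` functions and the Fourier integral. -/
theorem MeasureTheory.integral_norm_sq_fourier {f : ℝ → ℂ} (h1 : Integrable f)
    (h2 : MemLp f 2) : ∫ x, ‖𝓕 f x‖ ^ 2 = ∫ x, ‖f x‖ ^ 2 := by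
  have e1 : ∫ x, ‖𝓕 f x‖ ^ 2 = ‖(𝓕 (h2.toLp f) : Lp (α := ℝ) ℂ 2 volume)‖ ^ 2 := by
    rw [Lp.norm_sq_eq_integral]
    refine integral_congr_ae ?_
    filter_upwards [MemLp.fourier_toLp_ae_eq h1 h2] with x hx
    rw [hx]
  rw [e1, Lp.norm_fourier_eq, Lp.norm_sq_eq_integral]
  refine integral_congr_ae ?_
  filter_upwards [h2.coeFn_toLp] with x hx
  rw [hx]

end Plancherel

/-! ### Laplace transform of a power and the total mass -/

namespace CRR

open MeasureTheory Set Complex Filter Topology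

/-- The modulus does not depend on y, so a single integrable bound dominates for all y. -/
theorem norm_cpow_mul_exp (s : ℂ) (y : ℝ) {t : ℝ} (ht : 0 < t) :
    ‖(t : ℂ) ^ s * cexp (-((1 + y * I) * t))‖ = t ^ s.re * Real.exp (-t) := by
  rw [norm_mul, norm_cpow_eq_rpow_re_of_pos ht, norm_exp]
  simp

theorem continuousOn_cpow_mul_exp (s : ℂ) (y : ℝ) :
    ContinuousOn (fun t : ℝ => (t : ℂ) ^ s * cexp (-((1 + y * I) * t))) (Ioi 0) := by
  refine ContinuousOn.mul (fun t ht => ?_) (by fun_prop)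
  exact ((continuousAt_ofReal_cpow_const t s (Or.inr (ne_of_gt ht)))).continuousWithinAt

theorem integrableOn_rpow_mul_exp {a : ℝ} (ha : -1 < a) :
    IntegrableOn (fun t : ℝ => t ^ a * Real.exp (-t)) (Ioi 0) := by
  have := Real.GammaIntegral_convergent (s := a + 1) (by linarith)
  simpa [mul_comm] using this

theorem integrableOn_cpow_mul_exp {s : ℂ} (hs : -1 < s.re) (y : ℝ) :
    IntegrableOn (fun t : ℝ => (t : ℂ) ^ s * cexp (-((1 + y * I) * t))) (Ioi 0) := by
  refine (integrableOn_rpow_mul_exp hs).mono'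
    ((continuousOn_cpow_mul_exp s y).aestronglyMeasurable measurableSet_Ioi) ?_
  filter_upwards [ae_restrict_mem measurableSet_Ioi] with t ht
  exact (norm_cpow_mul_exp s y ht).le

/-- Integration by parts for the Laplace transform of `t ^ (b - 1)`. -/
theorem integral_cpow_mul_exp_succ {b : ℂ} (hb : 0 < b.re) (y : ℝ) :
    (1 + y * I) * ∫ t in Ioi (0 : ℝ), (t : ℂ) ^ b * cexp (-((1 + y * I) * t)) =
      b * ∫ t in Ioi (0 : ℝ), (t : ℂ) ^ (b - 1) * cexp (-((1 + y * I) * t)) := by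
  have hd : ∀ t ∈ Ioi (0 : ℝ), HasDerivAt
      (fun t : ℝ => (t : ℂ) ^ b * cexp (-((1 + y * I) * t)))
      (b * ((t : ℂ) ^ (b - 1) * cexp (-((1 + y * I) * t))) -
        (1 + y * I) * ((t : ℂ) ^ b * cexp (-((1 + y * I) * t)))) t := by
    intro t ht
    have h1 : HasDerivAt (fun t : ℝ => (t : ℂ) ^ b) (b * (t : ℂ) ^ (b - 1)) t :=
      hasDerivAt_ofReal_cpow_const (ne_of_gt ht) (by rintro rfl; simp at hb)
    have h2 : HasDerivAt (fun t : ℝ => -((1 + y * I) * (t : ℂ))) (-((1 + y * I) * 1)) t :=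
      ((ofRealCLM.hasDerivAt (x := t)).const_mul _).neg
    refine (h1.mul h2.cexp).congr_deriv ?_
    ring
  have hi1 := (integrableOn_cpow_mul_exp (s := b - 1) (by simpa using hb) y).const_mul b
  have hi2 := (integrableOn_cpow_mul_exp (s := b) (by linarith) y).const_mul (1 + y * I)
  have hb0 : b ≠ 0 := by rintro rfl; simp at hb
  have hzero : ContinuousAt (fun t : ℝ => (t : ℂ) ^ b * cexp (-((1 + y * I) * t))) 0 :=
    (continuousAt_ofReal_cpow_const 0 b (Or.inl hb)).mul (by fun_prop)
  have hinf : Tendsto (fun t : ℝ => (t : ℂ) ^ b * cexp (-((1 + y * I) * t))) atTop (𝓝 0) := by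
    have h0 := tendsto_rpow_mul_exp_neg_mul_atTop_nhds_zero b.re 1 one_pos
    refine squeeze_zero_norm' ?_ h0
    filter_upwards [eventually_gt_atTop 0] with t ht
    rw [norm_cpow_mul_exp b y ht, neg_one_mul]
  have h := integral_Ioi_of_hasDerivAt_of_tendsto hzero.continuousWithinAt hd (hi1.sub hi2) hinf
  rw [integral_sub hi1 hi2, integral_const_mul, integral_const_mul] at h
  simp only [ofReal_zero, zero_cpow hb0, zero_mul, sub_zero] at h
  exact (sub_eq_zero.1 h).symm

theorem hasDerivAt_integral_cpow_mul_exp {b : ℂ} (hb : 0 < b.re) (y : ℝ) :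
    HasDerivAt (fun y : ℝ => ∫ t in Ioi (0 : ℝ), (t : ℂ) ^ (b - 1) * cexp (-((1 + y * I) * t)))
      (-I * ∫ t in Ioi (0 : ℝ), (t : ℂ) ^ b * cexp (-((1 + y * I) * t))) y := by
  rw [← integral_const_mul]
  refine (hasDerivAt_integral_of_dominated_loc_of_deriv_le (s := univ) univ_mem
    (F' := fun (y t : ℝ) => -I * ((t : ℂ) ^ b * cexp (-((1 + y * I) * t))))
    (bound := fun t => t ^ b.re * Real.exp (-t))
    (Eventually.of_forall fun y => (continuousOn_cpow_mul_exp _ y).aestronglyMeasurable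
      measurableSet_Ioi) (integrableOn_cpow_mul_exp (by simpa using hb) y)
    (((continuousOn_cpow_mul_exp _ y).aestronglyMeasurable measurableSet_Ioi).const_mul _)
    ?_ (integrableOn_rpow_mul_exp (by linarith)) ?_).2
  · filter_upwards [ae_restrict_mem measurableSet_Ioi] with t ht x _
    rw [norm_mul, norm_neg, norm_I, one_mul, norm_cpow_mul_exp b x ht]
  · filter_upwards [ae_restrict_mem measurableSet_Ioi] with t ht x _
    have ht0 : (t : ℂ) ≠ 0 := ofReal_ne_zero.2 (ne_of_gt ht)
    have h2 : HasDerivAt (fun x : ℝ => -((1 + x * I) * (t : ℂ))) (-(1 * I * t)) x :=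
      ((((ofRealCLM.hasDerivAt (x := x)).mul_const I).const_add 1).mul_const (t : ℂ)).neg
    refine (h2.cexp.const_mul ((t : ℂ) ^ (b - 1))).congr_deriv ?_
    rw [cpow_sub _ _ ht0, cpow_one]
    field_simp

theorem one_add_mul_I_mem_slitPlane (y : ℝ) : 1 + y * I ∈ slitPlane := by
  left; simp

/-- No contour rotation: the left side has zero derivative in y by the integration by parts above,
and at y = 0 it is Euler's integral. -/
theorem cpow_mul_integral_cpow_mul_exp {b : ℂ} (hb : 0 < b.re) (y : ℝ) :
    (1 + y * I) ^ b * ∫ t in Ioi (0 : ℝ), (t : ℂ) ^ (b - 1) * cexp (-((1 + y * I) * t)) =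
      Complex.Gamma b := by
  have hd : ∀ y : ℝ, HasDerivAt (fun y : ℝ => (1 + y * I) ^ b *
      ∫ t in Ioi (0 : ℝ), (t : ℂ) ^ (b - 1) * cexp (-((1 + y * I) * t))) 0 y := by
    intro y
    have h1 : HasDerivAt (fun x : ℂ => 1 + x * I) (1 * I) (y : ℂ) :=
      ((hasDerivAt_id (y : ℂ)).mul_const I).const_add 1
    have h2 := (h1.cpow_const (c := b) (one_add_mul_I_mem_slitPlane y)).comp_ofReal.mul
      (hasDerivAt_integral_cpow_mul_exp hb y)
    have h0 := slitPlane_ne_zero (one_add_mul_I_mem_slitPlane y)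
    refine h2.congr_deriv ?_
    have h3 := integral_cpow_mul_exp_succ hb y
    have h4 : (1 + y * I) ^ b = (1 + y * I) ^ (b - 1) * (1 + y * I) := by
      rw [cpow_sub _ _ h0, cpow_one]; field_simp
    rw [h4]
    linear_combination (-I * (1 + y * I) ^ (b - 1)) * h3
  have hc := is_const_of_deriv_eq_zero (fun y => (hd y).differentiableAt)
    (fun y => (hd y).deriv) y 0
  rw [hc, Gamma_eq_integral hb, GammaIntegral]
  simp [mul_comm]

theorem norm_one_add_mul_I (y : ℝ) : ‖1 + y * I‖ = √(1 + y ^ 2) := by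
  simpa using norm_add_mul_I 1 y

/-- The argument of 1 + iy is arctan y = π/2 - arccot y; the π/2 produces the factor e^(ηπ). -/
theorem norm_cpow_one_add_mul_I_sq (b : ℂ) (y : ℝ) :
    ‖(1 + y * I) ^ b‖ ^ 2 = (Real.exp (b.im * Real.pi) * omega (2 * b.im) (-b.re + 1) y)⁻¹ := by
  have h0 := slitPlane_ne_zero (one_add_mul_I_mem_slitPlane y)
  have hy := one_add_sq_pos y
  have harg : arg (1 + y * I) = Real.arctan y := by
    rw [arg_of_re_nonneg (by simp), norm_one_add_mul_I, Real.arctan_eq_arcsin]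
    simp
  have hw : Real.exp (b.im * Real.pi) * omega (2 * b.im) (-b.re + 1) y =
      (1 + y ^ 2) ^ (-b.re) * Real.exp (2 * (Real.arctan y * b.im)) := by
    rw [omega_eq, mul_left_comm, ← Real.exp_add, arccot]
    congr 2
    ring
  rw [hw, norm_cpow_of_ne_zero h0, harg, norm_one_add_mul_I, div_pow, ← Real.exp_nat_mul,
    Real.sqrt_eq_rpow, ← Real.rpow_mul hy.le, ← Real.rpow_mul_natCast hy.le, Real.rpow_neg hy.le,
    mul_inv, inv_inv, div_eq_mul_inv]
  congr 2
  push_cast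
  ring

/-- Cauchy's beta integral for conjugate parameters. -/
theorem norm_Gamma_sq_mul_integral_omega {b : ℂ} (hb : 1 / 2 < b.re) :
    ‖Complex.Gamma b‖ ^ 2 * (Real.exp (b.im * Real.pi) / (2 * Real.pi)) *
        ∫ x, omega (2 * b.im) (-b.re + 1) x =
      (1 / 2) ^ (2 * b.re - 1) * Real.Gamma (2 * b.re - 1) := by
  set f : ℝ → ℂ := (Ioi 0).indicator
    fun t : ℝ => (t : ℂ) ^ (b - 1) * cexp (-((1 + (0 : ℝ) * I) * t)) with hf
  have hsq : (fun t => ‖f t‖ ^ 2) = (Ioi 0).indicator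
      fun t : ℝ => t ^ (2 * b.re - 1 - 1) * Real.exp (-(2 * t)) := by
    funext t
    by_cases ht : t ∈ Ioi (0 : ℝ)
    · rw [hf, indicator_of_mem ht, indicator_of_mem ht, norm_cpow_mul_exp _ _ ht, mul_pow,
        ← Real.rpow_mul_natCast (le_of_lt ht), ← Real.exp_nat_mul]
      congr 2
      · simp; ring
      · push_cast; ring
    · simp [hf, ht]
  have h1 : Integrable f := (integrable_indicator_iff measurableSet_Ioi).2
    (integrableOn_cpow_mul_exp (by simp; linarith) 0)
  -- Square integrability at 0 is where λ > 1/2 enters; elsewhere e^(-2t) ≤ e^(-t) suffices.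
  have h2 : MemLp f 2 := by
    rw [memLp_two_iff_integrable_sq_norm h1.aestronglyMeasurable, hsq,
      integrable_indicator_iff measurableSet_Ioi]
    refine (integrableOn_rpow_mul_exp (a := 2 * b.re - 1 - 1) (by linarith)).mono'
      (ContinuousOn.aestronglyMeasurable (fun t ht => ?_) measurableSet_Ioi) ?_
    · exact ((Real.continuousAt_rpow_const _ _ (Or.inl (ne_of_gt ht))).mul
        (by fun_prop)).continuousWithinAt
    · filter_upwards [ae_restrict_mem measurableSet_Ioi] with t ht
      have ht' : 0 < t := ht
      rw [Real.norm_of_nonneg (by positivity)]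
      gcongr
      linarith
  have hF : ∀ ξ : ℝ, ‖FourierTransform.fourier f ξ‖ ^ 2 = ‖Complex.Gamma b‖ ^ 2 *
      (Real.exp (b.im * Real.pi) * omega (2 * b.im) (-b.re + 1) (2 * Real.pi * ξ)) := by
    intro ξ
    have e : FourierTransform.fourier f ξ = ∫ t in Ioi (0 : ℝ), (t : ℂ) ^ (b - 1) *
        cexp (-((1 + (2 * Real.pi * ξ : ℝ) * I) * t)) := by
      rw [Real.fourier_real_eq_integral_exp_smul, ← integral_indicator measurableSet_Ioi]
      congr 1
      funext t
      by_cases ht : t ∈ Ioi (0 : ℝ)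
      · rw [hf, indicator_of_mem ht, indicator_of_mem ht, smul_eq_mul, mul_left_comm, ← exp_add]
        congr 2
        push_cast
        ring
      · simp [hf, ht]
    have hg := cpow_mul_integral_cpow_mul_exp (b := b) (by linarith) (2 * Real.pi * ξ)
    rw [← e] at hg
    have hw := omega_pos b (2 * Real.pi * ξ)
    rw [← hg, norm_mul, mul_pow, norm_cpow_one_add_mul_I_sq]
    generalize omega (2 * b.im) (-b.re + 1) (2 * Real.pi * ξ) = w at hw
    field_simp
  have key := integral_norm_sq_fourier h1 h2
  rw [hsq, integral_indicator measurableSet_Ioi,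
    Real.integral_rpow_mul_exp_neg_mul_Ioi (by linarith) two_pos] at key
  simp_rw [hF] at key
  -- The substitution x = 2πξ supplies the 1/(2π) of the constant.
  rw [integral_const_mul, integral_const_mul,
    Measure.integral_comp_mul_left (omega (2 * b.im) (-b.re + 1)) (2 * Real.pi),
    abs_of_pos (by positivity), smul_eq_mul] at key
  rw [← key]
  field_simp

theorem nuConst_mul_integral_omega {b : ℂ} (hb : 1 / 2 < b.re) :
    nuConst b * ∫ x, omega (2 * b.im) (-b.re + 1) x = 1 := by
  have h := norm_Gamma_sq_mul_integral_omega hb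
  have hG : 0 < Real.Gamma (2 * b.re - 1) := Real.Gamma_pos_of_pos (by linarith)
  have h2 : (2 : ℝ) ^ (2 * b.re - 1) * (1 / 2) ^ (2 * b.re - 1) = 1 := by
    rw [← Real.mul_rpow (by norm_num) (by norm_num)]; norm_num
  calc _ = 2 ^ (2 * b.re - 1) / Real.Gamma (2 * b.re - 1) *
        (‖Complex.Gamma b‖ ^ 2 * (Real.exp (b.im * Real.pi) / (2 * Real.pi)) *
        ∫ x, omega (2 * b.im) (-b.re + 1) x) := by rw [nuConst]; ring
    _ = 2 ^ (2 * b.re - 1) * (1 / 2) ^ (2 * b.re - 1) := by rw [h]; field_simp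
    _ = 1 := h2

end CRR

/-! ### Assembly of the three claims -/

theorem theorem1p1 (b : ℂ) (hb : 0 < b.re) :
    -- hypergeometric expression: `P_n(b;·)` is a polynomial, given by the formula at every
    -- real (and complex) point where the right-hand side makes sense
    (∀ n : ℕ, 1 ≤ n → ∃ p : ℝ[X], (∀ x : ℝ, CRR.P b n x = p.eval x) ∧
      ∀ z : ℂ, z ≠ Complex.I →
        aeval z p = (z - Complex.I) ^ n / 2 ^ n
          * ((CRR.poch (2 * b.re) n : ℂ) / (CRR.poch b.re n : ℂ))
          * ordinaryHypergeometric (-(n : ℂ)) b (b + (starRingEnd ℂ) b)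
              (-2 * Complex.I / (z - Complex.I))) ∧
    -- three term recurrence
    (∀ x : ℝ, CRR.P b 0 x = 1) ∧
    (∀ x : ℝ, CRR.P b 1 x = x - CRR.c b 1) ∧
    (∀ n : ℕ, 1 ≤ n → ∀ x : ℝ,
      CRR.P b (n + 1) x = (x - CRR.c b (n + 1)) * CRR.P b n x
        - CRR.dSucc b.re n * (x ^ 2 + 1) * CRR.P b (n - 1) x) ∧
    -- orthogonality
    (1 / 2 < b.re →
      (∀ x : ℝ, CRR.nu b x = CRR.nuConst b *
        ((Real.exp (-CRR.arccot x)) ^ (2 * b.im) / (1 + x ^ 2) ^ b.re)) ∧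
      MeasureTheory.Integrable (CRR.nu b) ∧
      (∫ x : ℝ, CRR.nu b x) = 1 ∧
      ∀ n m : ℕ, m ≤ n →
        MeasureTheory.Integrable
          (fun x : ℝ => x ^ m * (CRR.P b n x / (1 + x ^ 2) ^ n) * CRR.nu b x) ∧
        (∫ x : ℝ, x ^ m * (CRR.P b n x / (1 + x ^ 2) ^ n) * CRR.nu b x)
          = if m = n then CRR.gam b.re n else 0) := by
  have hpoch : ∀ n, CRR.poch b.re n ≠ 0 := fun n => (CRR.poch_pos hb n).ne'
  refine ⟨fun n _ => ⟨C (2 ^ n * CRR.poch b.re n)⁻¹ * CRR.rodriguesPoly b n, fun x => ?_,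
    fun z hz => ?_⟩, fun x => ?_, fun x => ?_, fun n hn x => CRR.P_three_term hb hn x,
    fun hb' => ?_⟩
  · rw [CRR.P_eq, eval_mul, eval_C]
  · have h : (CRR.poch b.re n : ℂ) ≠ 0 := Complex.ofReal_ne_zero.2 (hpoch n)
    rw [map_mul, aeval_C, CRR.aeval_rodriguesPoly b hb n hz, Complex.coe_algebraMap]
    push_cast
    field_simp
  · rw [CRR.P_eq, CRR.rodriguesPoly_zero, CRR.poch_zero]; simp
  · rw [CRR.P_eq, CRR.rodriguesPoly_succ, CRR.rodriguesPoly_zero, CRR.poch_succ, CRR.poch_zero,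
      CRR.c]
    simp
    field_simp
  · have hW := CRR.nuConst_mul_integral_omega hb'
    have hi : MeasureTheory.Integrable (CRR.omega (2 * b.im) (-b.re + 1)) := by
      simpa [CRR.omegaDeriv, CRR.rodriguesPoly_zero] using
        CRR.integrable_pow_mul_omegaDeriv hb' (n := 0) (m := 0) le_rfl
    refine ⟨fun x => ?_, hi.const_mul _, ?_, fun n m hm => ⟨?_, ?_⟩⟩
    · rw [CRR.nu, CRR.omega, add_sub_cancel_right, Real.rpow_neg (CRR.one_add_sq_pos x).le]
      ring
    · rw [← hW, ← MeasureTheory.integral_const_mul]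
      rfl
    · simp_rw [CRR.pow_mul_P_mul_nu]
      exact (CRR.integrable_pow_mul_omegaDeriv hb' hm).const_mul _
    · simp_rw [CRR.pow_mul_P_mul_nu]
      rw [MeasureTheory.integral_const_mul, CRR.integral_pow_mul_omegaDeriv hb' hm]
      split_ifs
      · have hs : ((-1 : ℝ) ^ n) * (-1) ^ n = 1 := by rw [← mul_pow]; simp
        rw [CRR.gam_eq hb]
        linear_combination ((2 ^ n * CRR.poch b.re n)⁻¹ * n.factorial *
          (CRR.nuConst b * ∫ x, CRR.omega (2 * b.im) (-b.re + 1) x)) * hs +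
          ((2 ^ n * CRR.poch b.re n)⁻¹ * n.factorial) * hW
      · rw [mul_zero]
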